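/- Let $d,l\in\mathbb N$, let $E\subset\mathbb R^l$ be countable, and regard $\mathbb Z^d\times E$ as a subset of $\mathbb R^{d+l}$, with Euclidean norm $|\cdot|$. Let $\mathcal Z=(\mathcal Z(t))_{t\in\mathbb N}$ be a Markov chain on $\mathbb Z^d\times E$ whose transition matrix $p$ may be strictly substochastic ($\sum_{z'}p(z,z')\le 1$; the missing mass is a killing probability), and which is Markov-additive: $p((x,y),(x',y'))=p((0,y),(x'-x,y'))$ for all $x,x'\in\mathbb Z^d$, $y,y'\in E$. Let $\mathcal G(z,z')=\sum_{t\ge 0}\mathbb P_z(\mathcal Z(t)=z')$ be its Green function. Assume that: (i) $\mathcal Z$ is transient, i.e. $\mathcal G(z,z)<\infty$ for all $z$; (ii) (communication condition) there are $\theta>0$ and $C>0$ such that for all $z\ne z'$ in $\mathbb Z^d\times E$ there are $n\le C|z'-z|$ and points $z=\zeta_0,\zeta_1,\dots,\zeta_n=z'$ of $\mathbb Z^d\times E$ with $|\zeta_i-\zeta_{i-1}|\le C$ and $p(\zeta_{i-1},\zeta_i)\ge\theta$ for $i=1,\dots,n$; (iii) (exponential moment condition) $\hat\varphi(a)=\sup_{z\in\mathbb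 Z^d\times E}\sum_{z'}p(z,z')\,e^{a\cdot(z'-z)}$ is finite for all $a$ in a neighbourhood of $0$ in $\mathbb R^{d+l}$. Let $\hat k$ be the greatest common divisor of the set of all integers $k>0$ with $\inf_{z\in\mathbb Z^d\times E}\mathbb P_z(\mathcal Z(k)=z)>0$. Let $(z_n)$ be a sequence in $\mathbb Z^d\times E$ with $|z_n|\to\infty$ and $$\lim_{\delta\downarrow 0}\ \liminf_{n\to\infty}\ \inf_{z\in\mathbb Z^d\times E:\,|z|<\delta|z_n|}\ \frac1{|z_n|}\log\mathcal G(z,z_n)\ \ge\ 0 .$$ Then, for every $w\in\mathbb Z^d\times\{0\}$, $$\lim_{\delta\downarrow0}\ \liminf_{n\to\infty}\ \inf_{|z|<\delta|z_n|}\frac{\mathcal G(z+\hat k w,z_n)}{\mathcal G(z,z_n)}\;=\;\lim_{\delta\downarrow0}\ \limsup_{n\to\infty}\ \sup_{|z|<\delta|z_n|}\frac{\mathcal G(z+\hat k w,z_n)}{\mathcal G(z,z_n)}\;=\;1 ,$$ where the infimum and the supremum are over $z\in\mathbb Z^d\times E$. -/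

import Mathlib

open Filter Topology
open scoped ENNReal

namespace MarkovAdditive

/-- The set `ℤ^d × E` with `E ⊆ ℝ^l`. -/
abbrev State (d : ℕ) {l : ℕ} (E : Set (EuclideanSpace ℝ (Fin l))) : Type :=
  (Fin d → ℤ) × E

/-- The inclusion of `ℤ^d × E` in the Euclidean space `ℝ^(d+l)`. -/
noncomputable def toEuclid {d l : ℕ} {E : Set (EuclideanSpace ℝ (Fin l))} (z : State d E) :
    EuclideanSpace ℝ (Fin d ⊕ Fin l) :=
  WithLp.toLp 2 (Sum.elim (fun i => ((z.1 i : ℤ) : ℝ)) (fun j => (z.2 : EuclideanSpace ℝ (Fin l)) j))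

/-- The Euclidean norm `|z|` of a state. -/
noncomputable def size {d l : ℕ} {E : Set (EuclideanSpace ℝ (Fin l))} (z : State d E) : ℝ :=
  ‖toEuclid z‖

/-- The state `z + (v, 0)`, for `v ∈ ℤ^d`. -/
def shift {d l : ℕ} {E : Set (EuclideanSpace ℝ (Fin l))} (z : State d E) (v : Fin d → ℤ) :
    State d E :=
  (z.1 + v, z.2)

/-- A (possibly strictly) substochastic transition matrix: the missing mass is the probability
that the chain is killed. -/
def IsSubstochastic {S : Type*} (p : S → S → ℝ≥0∞) : Prop :=
  ∀ z, ∑' z', p z z' ≤ 1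

/-- `p((x,y),(x',y')) = p((0,y),(x'-x,y'))`. -/
def IsMarkovAdditive {d l : ℕ} {E : Set (EuclideanSpace ℝ (Fin l))}
    (p : State d E → State d E → ℝ≥0∞) : Prop :=
  ∀ (x x' : Fin d → ℤ) (y y' : E), p (x, y) (x', y') = p (0, y) (x' - x, y')

open Classical in
/-- The `t`-step transition probability `P_z(Z(t) = z')` of the chain with transition matrix `p`. -/
noncomputable def stepProb {S : Type*} (p : S → S → ℝ≥0∞) : ℕ → S → S → ℝ≥0∞
  | 0, z, z' => if z = z' then 1 else 0
  | t + 1, z, z' => ∑' u, p z u * stepProb p t u z'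

/-- The Green function `G(z,z') = ∑_{t ≥ 0} P_z(Z(t) = z')`. -/
noncomputable def green {S : Type*} (p : S → S → ℝ≥0∞) (z z' : S) : ℝ≥0∞ :=
  ∑' t : ℕ, stepProb p t z z'

/-- Every state is transient, i.e. its expected number of visits to itself is finite. -/
def IsTransient {S : Type*} (p : S → S → ℝ≥0∞) : Prop :=
  ∀ z, green p z z < ∞

/-- The communication condition on the whole state space. -/
def CommunicationCondition {d l : ℕ} {E : Set (EuclideanSpace ℝ (Fin l))}
    (p : State d E → State d E → ℝ≥0∞) : Prop :=
  ∃ θ : ℝ, 0 < θ ∧ ∃ C : ℝ, 0 < C ∧ ∀ z z' : State d E, z ≠ z' →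
    ∃ (n : ℕ) (path : ℕ → State d E), path 0 = z ∧ path n = z' ∧
      (n : ℝ) ≤ C * ‖toEuclid z' - toEuclid z‖ ∧
      ∀ i < n, ‖toEuclid (path (i + 1)) - toEuclid (path i)‖ ≤ C ∧
        ENNReal.ofReal θ ≤ p (path i) (path (i + 1))

/-- `sup_z E_z(exp(a · (Z(1) - z)))`, the expectation being over the event that the chain is
not killed at time `1`. -/
noncomputable def expMoment {d l : ℕ} {E : Set (EuclideanSpace ℝ (Fin l))}
    (p : State d E → State d E → ℝ≥0∞) (a : EuclideanSpace ℝ (Fin d ⊕ Fin l)) : ℝ≥0∞ :=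
  ⨆ z, ∑' z', p z z' * ENNReal.ofReal (Real.exp (inner ℝ a (toEuclid z' - toEuclid z)))

/-- The exponential moments are uniformly finite in a neighbourhood of zero in `ℝ^(d+l)`. -/
def ExpMomentCondition {d l : ℕ} {E : Set (EuclideanSpace ℝ (Fin l))}
    (p : State d E → State d E → ℝ≥0∞) : Prop :=
  ∀ᶠ a in 𝓝 (0 : EuclideanSpace ℝ (Fin d ⊕ Fin l)), expMoment p a < ∞

/-- The integers `k > 0` with `inf_z P_z(Z(k) = z) > 0`. -/
def returnTimes {S : Type*} (p : S → S → ℝ≥0∞) : Set ℕ :=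
  {k | 0 < k ∧ 0 < ⨅ z, stepProb p k z z}

/-- The greatest common divisor of the uniform return times. -/
noncomputable def period {S : Type*} (p : S → S → ℝ≥0∞) : ℕ :=
  Nat.setGcd (returnTimes p)

/-- `liminf_n inf_{|z| < δ|z_n|} f(z, z_n)`. -/
noncomputable def lowerLim {d l : ℕ} {E : Set (EuclideanSpace ℝ (Fin l))} {α : Type*}
    [CompleteLattice α] (zs : ℕ → State d E) (f : State d E → State d E → α) (δ : ℝ) : α :=
  liminf (fun n => ⨅ z ∈ {z : State d E | size z < δ * size (zs n)}, f z (zs n)) atTop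

/-- `limsup_n sup_{|z| < δ|z_n|} f(z, z_n)`. -/
noncomputable def upperLim {d l : ℕ} {E : Set (EuclideanSpace ℝ (Fin l))} {α : Type*}
    [CompleteLattice α] (zs : ℕ → State d E) (f : State d E → State d E → α) (δ : ℝ) : α :=
  limsup (fun n => ⨆ z ∈ {z : State d E | size z < δ * size (zs n)}, f z (zs n)) atTop

end MarkovAdditive

/-! Write τ for translation by `period p • w`. Communication yields one time K at which staying put
and moving by τ both have probability at least ε from every state (`exists_uniform_shift`). The
K-step operator is therefore q + ε(1 + τ), where q commutes with τ by additivity. In the binomial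
expansion of its powers, τ only has to be compared with 1 on (1 + τ)^j. Shifting a symmetric
binomial law by one costs a factor x > 1 and an exponentially small tail. Hence p^t(τz, z') ≤ x
p^t(z, z') + cρ^t with ρ < 1 (`stepProb_comp_le`).

Exponential moments also give p^t(τz, z') ≤ M^t exp(-r|z' - τz|), which is the better bound for
small t. A weighted geometric mean of the two errors is summable in t and exponentially small in the
distance, so G(τz, z') ≤ x G(z, z') + C exp(-β|z' - τz|) (`green_shift_le_add_exp`). By the
logarithmic hypothesis G(z, z_n) eventually exceeds exp(-γ|z_n|) for each γ > 0, so the error is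
negligible. Replacing w by -w gives the reverse bound. -/

namespace MarkovAdditive

/-! ### Kernels as operators on nonnegative functions -/

section Kernel

variable {S : Type*}

/-- The operator `f ↦ ∑ u, q · u * f u` on nonnegative functions. -/
noncomputable def kernelOp (q : S → S → ℝ≥0∞) : Module.End ℝ≥0∞ (S → ℝ≥0∞) where
  toFun f z := ∑' u, q z u * f u
  map_add' f g := by
    funext z
    simp [mul_add, ENNReal.tsum_add]
  map_smul' c f := by
    funext z
    simp [← ENNReal.tsum_mul_left, mul_left_comm]

theorem kernelOp_apply (q : S → S → ℝ≥0∞) (f : S → ℝ≥0∞) (z : S) :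
    kernelOp q f z = ∑' u, q z u * f u := rfl

theorem kernelOp_mono (q : S → S → ℝ≥0∞) : Monotone (kernelOp q) := fun _ _ h _ =>
  ENNReal.tsum_le_tsum fun u => mul_le_mul_right (h u) _

theorem pow_kernelOp_mono (q : S → S → ℝ≥0∞) (t : ℕ) : Monotone (kernelOp q ^ t) := by
  rw [Module.End.coe_pow]
  exact (kernelOp_mono q).iterate t

open Classical in
theorem stepProb_eq_pow_kernelOp (p : S → S → ℝ≥0∞) (t : ℕ) (z z' : S) :
    stepProb p t z z' = (kernelOp p ^ t) (Pi.single z' 1) z := by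
  induction t generalizing z with
  | zero => simp [stepProb, Pi.single_apply]
  | succ t ih => simp [stepProb, pow_succ', kernelOp_apply, ih]

theorem kernelOp_stepProb (p : S → S → ℝ≥0∞) (t : ℕ) :
    kernelOp (stepProb p t) = kernelOp p ^ t := by
  classical
  induction t with
  | zero =>
    ext f z
    simp [kernelOp_apply, stepProb]
  | succ t ih =>
    refine LinearMap.ext fun f => funext fun z => ?_
    rw [pow_succ', Module.End.mul_apply, ← ih]
    simp only [kernelOp_apply, stepProb, ← ENNReal.tsum_mul_left, ← ENNReal.tsum_mul_right]
    rw [ENNReal.tsum_comm]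
    simp only [mul_assoc]

theorem stepProb_add_ge (p : S → S → ℝ≥0∞) (m n : ℕ) (z u z' : S) :
    stepProb p m z u * stepProb p n u z' ≤ stepProb p (m + n) z z' := by
  classical
  rw [stepProb_eq_pow_kernelOp p (m + n), pow_add, Module.End.mul_apply, ← kernelOp_stepProb p m,
    kernelOp_apply, stepProb_eq_pow_kernelOp p n]
  exact ENNReal.le_tsum u

/-- Used with h = 1 to bound total mass, and with h an exponential to obtain spatial decay. -/
theorem pow_kernelOp_le_smul {q : S → S → ℝ≥0∞} {m : ℝ≥0∞} {h : S → ℝ≥0∞}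
    (hq : kernelOp q h ≤ m • h) (t : ℕ) : (kernelOp q ^ t) h ≤ m ^ t • h := by
  induction t with
  | zero => simp
  | succ t ih =>
    rw [pow_succ', Module.End.mul_apply]
    refine (kernelOp_mono q ih).trans ?_
    rw [map_smul, pow_succ, mul_smul]
    exact fun z => mul_le_mul_right (hq z) _

theorem pow_kernelOp_le_one {p : S → S → ℝ≥0∞} (hp : IsSubstochastic p) (t : ℕ)
    {f : S → ℝ≥0∞} (hf : f ≤ 1) : (kernelOp p ^ t) f ≤ 1 := by
  refine (pow_kernelOp_mono p t hf).trans ?_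
  have := pow_kernelOp_le_smul (q := p) (m := 1) (h := 1) (fun z => by simpa [kernelOp_apply] using hp z) t
  simpa using this

/-- The operator `f ↦ f ∘ τ`. -/
noncomputable def compOp (τ : S ≃ S) : Module.End ℝ≥0∞ (S → ℝ≥0∞) :=
  LinearMap.funLeft ℝ≥0∞ ℝ≥0∞ τ

@[simp] theorem compOp_apply (τ : S ≃ S) (f : S → ℝ≥0∞) (z : S) : compOp τ f z = f (τ z) := rfl

theorem commute_kernelOp_compOp {q : S → S → ℝ≥0∞} {τ : S ≃ S}
    (hq : ∀ z u, q (τ z) (τ u) = q z u) : Commute (kernelOp q) (compOp τ) := by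
  refine LinearMap.ext fun f => funext fun z => ?_
  simp only [Module.End.mul_apply, compOp_apply, kernelOp_apply]
  rw [← τ.tsum_eq fun u => q (τ z) u * f u]
  simp only [hq]

theorem pow_compOp_apply (τ : S ≃ S) (i : ℕ) (f : S → ℝ≥0∞) (z : S) :
    (compOp τ ^ i) f z = f (τ^[i] z) := by
  induction i generalizing z with
  | zero => rfl
  | succ i ih => rw [pow_succ', Module.End.mul_apply, compOp_apply, ih, Function.iterate_succ_apply]

theorem stepProb_invariant {p : S → S → ℝ≥0∞} {τ : S ≃ S}
    (hp : ∀ z u, p (τ z) (τ u) = p z u) (t : ℕ) (z u : S) :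
    stepProb p t (τ z) (τ u) = stepProb p t z u := by
  induction t generalizing z with
  | zero => by_cases h : z = u <;> simp [stepProb, h]
  | succ t ih =>
    simp only [stepProb]
    rw [← τ.tsum_eq fun v => p (τ z) v * stepProb p t v (τ u)]
    simp only [hp, ih]

end Kernel

/-! ### Shifting a symmetric binomial law -/

section Binomial

/-- Chernoff's bound at the level `x / (1 + x)` of the symmetric binomial distribution. -/
theorem exists_chernoff {x : ℝ} (hx : 1 < x) :
    ∃ y : ℝ, 0 < y ∧ (1 + x) * y < 2 ∧
      ∀ a b : ℕ, x * b ≤ (1 + x) * a → 1 ≤ x ^ a * y ^ b := by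
  have hx0 : 0 < x := by linarith
  set β := x / (1 + x) with hβ
  have h1 : 1 - β = (1 + x)⁻¹ := by rw [hβ]; field_simp; ring
  have hlt : Real.binEntropy β < Real.log 2 := by
    rw [Real.binEntropy_lt_log_two, hβ]
    intro h
    rw [div_eq_iff (by positivity)] at h
    linarith
  -- With this y, log((1 + x)y) is exactly the entropy of β, which is below log 2 because β ≠ 1/2;
  -- and x^a y^b ≥ 1 as soon as a ≥ βb.
  refine ⟨x ^ (-β), by positivity, ?_, fun a b hab => ?_⟩
  · rw [← Real.log_lt_log_iff (by positivity) (by norm_num), Real.log_mul (by positivity)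
      (by positivity), Real.log_rpow hx0]
    refine lt_of_eq_of_lt ?_ hlt
    rw [Real.binEntropy, h1, hβ, inv_inv, inv_div, Real.log_div (by positivity) (by positivity)]
    field_simp
    ring
  · rw [← Real.rpow_natCast, ← Real.rpow_natCast, ← Real.rpow_mul hx0.le, ← Real.rpow_add hx0]
    refine Real.one_le_rpow hx.le ?_
    have : β * b ≤ a := by
      rw [hβ, div_mul_eq_mul_div, div_le_iff₀ (by positivity)]
      linarith
    linarith

/-- The ratio of consecutive binomial coefficients is (i + 1)/(j - i). If it exceeds x, then i + 1
is at least the fraction x/(1 + x) of j + 1, which is the Chernoff regime. -/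
theorem choose_le_or_one_le {x y : ℝ} (hx : 1 < x)
    (hy : ∀ a b : ℕ, x * b ≤ (1 + x) * a → 1 ≤ x ^ a * y ^ b) {i j : ℕ} (hij : i ≤ j) :
    (j.choose i : ℝ) ≤ x * j.choose (i + 1) ∨ 1 ≤ x ^ (i + 1) * y ^ (j + 1) := by
  refine or_iff_not_imp_left.2 fun h => hy _ _ ?_
  push Not at h
  have hc : (j.choose (i + 1) : ℝ) * (i + 1) = j.choose i * (j - i) := by
    have := Nat.choose_succ_right_eq j i
    rw [← Nat.cast_sub hij]
    exact_mod_cast this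
  have hpos : (0 : ℝ) < j.choose i := by exact_mod_cast Nat.choose_pos hij
  push_cast
  have h2 : x * (j - i) ≤ i + 1 := by
    refine le_of_mul_le_mul_left ?_ hpos
    have hi : (0 : ℝ) ≤ (i : ℝ) + 1 := by positivity
    nlinarith [mul_le_mul_of_nonneg_right h.le hi]
  nlinarith

/-- Shifting a binomial distribution by one changes it by a factor close to one, up to an
exponentially small error. -/
theorem sum_choose_shift_le {x y : ℝ} (hx : 1 < x) (hy0 : 0 < y)
    (hy : ∀ a b : ℕ, x * b ≤ (1 + x) * a → 1 ≤ x ^ a * y ^ b) (j : ℕ)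
    {g : ℕ → ℝ≥0∞} (hg : ∀ i, g i ≤ 1) :
    ∑ i ∈ Finset.range (j + 1), (j.choose i : ℝ≥0∞) * g (i + 1) ≤
      ENNReal.ofReal x * ∑ i ∈ Finset.range (j + 1), (j.choose i : ℝ≥0∞) * g i +
        ENNReal.ofReal (x * y * ((1 + x) * y) ^ j) := by
  have hx0 : 0 < x := by linarith
  have hsum : x * y * ((1 + x) * y) ^ j =
      ∑ i ∈ Finset.range (j + 1), (j.choose i : ℝ) * (x ^ (i + 1) * y ^ (j + 1)) := by
    rw [mul_pow, add_comm 1 x, add_pow, Finset.sum_mul, Finset.mul_sum]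
    refine Finset.sum_congr rfl fun i _ => ?_
    ring
  have hterm : ∀ i ∈ Finset.range (j + 1), (j.choose i : ℝ≥0∞) * g (i + 1) ≤
      ENNReal.ofReal x * ((j.choose (i + 1) : ℝ≥0∞) * g (i + 1)) +
        ENNReal.ofReal ((j.choose i : ℝ) * (x ^ (i + 1) * y ^ (j + 1))) := by
    intro i hi
    rcases choose_le_or_one_le hx hy (Nat.lt_succ_iff.1 (Finset.mem_range.1 hi)) with h | h
    · refine le_add_right ?_
      rw [← mul_assoc]
      refine mul_le_mul_left ?_ _
      rw [← ENNReal.ofReal_natCast, ← ENNReal.ofReal_natCast, ← ENNReal.ofReal_mul hx0.le]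
      exact ENNReal.ofReal_le_ofReal h
    · refine le_add_left ?_
      calc (j.choose i : ℝ≥0∞) * g (i + 1) ≤ j.choose i := mul_le_of_le_one_right' (hg _)
        _ = ENNReal.ofReal (j.choose i : ℝ) := (ENNReal.ofReal_natCast _).symm
        _ ≤ _ := ENNReal.ofReal_le_ofReal (le_mul_of_one_le_right (by positivity) h)
  refine (Finset.sum_le_sum hterm).trans ?_
  rw [Finset.sum_add_distrib, hsum, ENNReal.ofReal_sum_of_nonneg fun i _ => by positivity,
    ← Finset.mul_sum]
  refine add_le_add_left (mul_le_mul_right ?_ _) _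
  -- The added term i = j + 1 vanishes; the reindexed sum then lacks only the term i = 0.
  have h0 : ∑ i ∈ Finset.range (j + 1 + 1), (j.choose i : ℝ≥0∞) * g i =
      ∑ i ∈ Finset.range (j + 1), (j.choose i : ℝ≥0∞) * g i := by
    rw [Finset.sum_range_succ]
    simp
  rw [← h0, Finset.sum_range_succ' (fun i => (j.choose i : ℝ≥0∞) * g i)]
  exact le_self_add

theorem one_add_compOp_pow_le {S : Type*} (τ : S ≃ S) {x y : ℝ} (hx : 1 < x) (hy0 : 0 < y)
    (hy : ∀ a b : ℕ, x * b ≤ (1 + x) * a → 1 ≤ x ^ a * y ^ b) (j : ℕ)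
    {f : S → ℝ≥0∞} (hf : f ≤ 1) :
    ((1 + compOp τ) ^ j) (compOp τ f) ≤ ENNReal.ofReal x • ((1 + compOp τ) ^ j) f +
      ENNReal.ofReal (x * y * ((1 + x) * y) ^ j) • 1 := by
  have key : ∀ (h : S → ℝ≥0∞) (z : S), ((1 + compOp τ) ^ j) h z =
      ∑ i ∈ Finset.range (j + 1), (j.choose i : ℝ≥0∞) * h (τ^[i] z) := by
    intro h z
    rw [add_comm, (Commute.one_right (compOp τ)).add_pow]
    simp only [one_pow, mul_one, LinearMap.sum_apply, Finset.sum_apply, ← nsmul_eq_mul',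
      LinearMap.smul_apply, Pi.smul_apply, pow_compOp_apply]
    simp only [nsmul_eq_mul]
  intro z
  simp only [Pi.add_apply, Pi.smul_apply, key, smul_eq_mul, Pi.one_apply, mul_one, compOp_apply,
    ← Function.iterate_succ_apply' τ]
  exact sum_choose_shift_le hx hy0 hy j (g := fun i => f (τ^[i] z)) fun i => hf _

end Binomial

/-! ### Comparison of transition probabilities -/

section Ratio

variable {S : Type*}

/-- The lazy part of a kernel: at least mass `ε` on staying and on applying `τ`. -/
theorem exists_kernelOp_eq_add {P : S → S → ℝ≥0∞} {τ : S ≃ S} {ε : ℝ≥0∞} (hP : kernelOp P 1 ≤ 1)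
    (hinv : ∀ z u, P (τ z) (τ u) = P z u) (hτ : ∀ z, τ z ≠ z)
    (h1 : ∀ z, ε ≤ P z z) (h2 : ∀ z, ε ≤ P z (τ z)) :
    ∃ q : S → S → ℝ≥0∞, kernelOp P = kernelOp q + ε • (1 + compOp τ) ∧
      Commute (kernelOp q) (ε • (1 + compOp τ)) ∧ kernelOp q 1 + (2 * ε) • 1 ≤ 1 := by
  classical
  -- Since τ has no fixed point, the two masses never fall on the same entry, so D ≤ P.
  set D : S → S → ℝ≥0∞ := fun z u => (if u = z then ε else 0) + (if u = τ z then ε else 0) with hD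
  have hDP : ∀ z u, D z u ≤ P z u := by
    intro z u
    simp only [hD]
    by_cases h : u = z
    · subst h
      simpa [(hτ u).symm] using h1 u
    · by_cases h' : u = τ z
      · subst h'
        simpa [hτ z] using h2 z
      · simp [h, h']
  have hDop : kernelOp D = ε • (1 + compOp τ) := by
    refine LinearMap.ext fun f => funext fun z => ?_
    simp [kernelOp_apply, hD, add_mul, ENNReal.tsum_add]
  have hsum : kernelOp P = kernelOp (fun z u => P z u - D z u) + ε • (1 + compOp τ) := by
    rw [← hDop]
    refine LinearMap.ext fun f => funext fun z => ?_
    simp only [LinearMap.add_apply, Pi.add_apply, kernelOp_apply, ← ENNReal.tsum_add, ← add_mul,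
      tsub_add_cancel_of_le (hDP _ _)]
  refine ⟨fun z u => P z u - D z u, hsum, ?_, ?_⟩
  · refine Commute.smul_right (Commute.add_right (Commute.one_right _) ?_) ε
    refine commute_kernelOp_compOp fun z u => ?_
    simp only [hinv, hD, τ.injective.eq_iff]
  · rw [hsum] at hP
    refine le_trans (le_of_eq ?_) hP
    funext z
    simp [two_mul]

/-- The binomial shift estimate is applied to each term q^m (ε(1 + τ))^(t-m) of P^t. As q has mass
at most 1 - 2ε, the errors resum by the binomial theorem to the t-th power of (1 - 2ε) + σε, and σ <
2 makes this less than 1. -/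
theorem pow_kernelOp_comp_le {P : S → S → ℝ≥0∞} {τ : S ≃ S} {ε : ℝ≥0∞} (hP : kernelOp P 1 ≤ 1)
    (hinv : ∀ z u, P (τ z) (τ u) = P z u) (hτ : ∀ z, τ z ≠ z) (hε : ε ≠ 0)
    (h1 : ∀ z, ε ≤ P z z) (h2 : ∀ z, ε ≤ P z (τ z)) {x : ℝ} (hx : 1 < x) :
    ∃ c κ : ℝ≥0∞, c < ∞ ∧ κ < 1 ∧ ∀ (t : ℕ) (f : S → ℝ≥0∞), f ≤ 1 → ∀ z,
      (kernelOp P ^ t) f (τ z) ≤ ENNReal.ofReal x * (kernelOp P ^ t) f z + c * κ ^ t := by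
  obtain ⟨q, hsum, hcomm, hmass⟩ := exists_kernelOp_eq_add hP hinv hτ h1 h2
  obtain ⟨y, hy0, hy2, hy⟩ := exists_chernoff hx
  have hx0 : 0 < x := by linarith
  have hcomm' : Commute (kernelOp P) (compOp τ) := commute_kernelOp_compOp hinv
  set σ : ℝ≥0∞ := ENNReal.ofReal ((1 + x) * y) with hσ
  have hσ2 : σ < 2 := by
    rw [hσ, ← ENNReal.ofReal_ofNat]
    exact (ENNReal.ofReal_lt_ofReal_iff (by norm_num)).2 hy2
  have herr : ∀ j : ℕ, ENNReal.ofReal (x * y * ((1 + x) * y) ^ j) =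
      ENNReal.ofReal (x * y) * σ ^ j := fun j => by
    rw [ENNReal.ofReal_mul (by positivity), ENNReal.ofReal_pow (by positivity)]
  by_cases hS : IsEmpty S
  · exact ⟨0, 0, by simp, by simp, fun t f _ z => isEmptyElim z⟩
  rw [not_isEmpty_iff] at hS
  obtain ⟨z₀⟩ := hS
  have h2ε : 2 * ε ≤ 1 := by
    refine le_trans ?_ (hmass z₀)
    simp
  have hεtop : ε ≠ ∞ := by
    rintro rfl
    simp at h2ε
  have h2εtop : 2 * ε ≠ ∞ := ENNReal.mul_ne_top (by simp) hεtop
  have hq : kernelOp q 1 ≤ (1 - 2 * ε) • 1 := fun z => by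
    have := hmass z
    simp only [Pi.add_apply, Pi.smul_apply, Pi.one_apply, smul_eq_mul, mul_one] at this ⊢
    exact ENNReal.le_sub_of_add_le_right h2εtop this
  refine ⟨ENNReal.ofReal (x * y), (1 - 2 * ε) + σ * ε, ENNReal.ofReal_lt_top, ?_,
    fun t f hf z => ?_⟩
  · calc (1 - 2 * ε) + σ * ε < (1 - 2 * ε) + 2 * ε := by
          refine ENNReal.add_lt_add_left (by simp) ?_
          exact (ENNReal.mul_lt_mul_iff_left hε hεtop).2 hσ2
      _ = 1 := tsub_add_cancel_of_le h2ε
  have hexp : ∀ g : S → ℝ≥0∞, (kernelOp P ^ t) g = ∑ m ∈ Finset.range (t + 1),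
      ((t.choose m : ℝ≥0∞) * ε ^ (t - m)) •
        (kernelOp q ^ m) (((1 + compOp τ) ^ (t - m)) g) := by
    intro g
    rw [hsum, hcomm.add_pow]
    simp only [LinearMap.sum_apply, ← nsmul_eq_mul', LinearMap.smul_apply, smul_pow,
      Module.End.mul_apply, map_smul, mul_smul]
    simp only [Nat.cast_smul_eq_nsmul]
  calc (kernelOp P ^ t) f (τ z) = (kernelOp P ^ t) (compOp τ f) z := by
        rw [← Module.End.mul_apply, (hcomm'.pow_left t).eq]
        rfl
    _ ≤ (∑ m ∈ Finset.range (t + 1), ((t.choose m : ℝ≥0∞) * ε ^ (t - m)) •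
          (ENNReal.ofReal x • (kernelOp q ^ m) (((1 + compOp τ) ^ (t - m)) f) +
            (ENNReal.ofReal (x * y) * σ ^ (t - m)) • ((1 - 2 * ε) ^ m • (1 : S → ℝ≥0∞)))) z := by
        rw [hexp, Finset.sum_apply, Finset.sum_apply]
        refine Finset.sum_le_sum fun m _ => mul_le_mul_right ?_ _
        refine (pow_kernelOp_mono q m (one_add_compOp_pow_le τ hx hy0 hy (t - m) hf) z).trans ?_
        rw [map_add, map_smul, map_smul, herr]
        exact add_le_add_right (mul_le_mul_right (pow_kernelOp_le_smul hq m z) _) _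
    _ = _ := by
        rw [hexp f, add_pow]
        simp only [Finset.sum_apply, Pi.smul_apply, Pi.add_apply, smul_eq_mul, Pi.one_apply,
          Finset.mul_sum, mul_add, Finset.sum_add_distrib]
        congr 1
        · exact Finset.sum_congr rfl fun m _ => by ring
        · exact Finset.sum_congr rfl fun m _ => by rw [mul_pow]; ring

theorem pow_div_le {κ : ℝ≥0∞} (hκ : κ < 1) {K : ℕ} (hK : 0 < K) :
    ∃ c ρ : ℝ, 0 < c ∧ 0 < ρ ∧ ρ < 1 ∧ ∀ t : ℕ, κ ^ (t / K) ≤ ENNReal.ofReal (c * ρ ^ t) := by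
  -- The maximum keeps a positive when κ = 0; the constant a⁻¹ below absorbs the rounding in t / K.
  set a : ℝ := max κ.toReal (1 / 2) with ha
  have ha0 : 0 < a := by positivity
  have ha1 : a < 1 := by
    refine max_lt ?_ (by norm_num)
    have := (ENNReal.toReal_lt_toReal hκ.ne_top (by simp)).2 hκ
    simpa using this
  have hKr : (0 : ℝ) < K := by exact_mod_cast hK
  set ρ : ℝ := a ^ ((K : ℝ)⁻¹) with hρ
  have hρ0 : 0 < ρ := by positivity
  have hρ1 : ρ < 1 := Real.rpow_lt_one ha0.le ha1 (by positivity)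
  have hρK : ρ ^ K = a := Real.rpow_inv_natCast_pow ha0.le hK.ne'
  refine ⟨a⁻¹, ρ, by positivity, hρ0, hρ1, fun t => ?_⟩
  have h1 : κ ≤ ENNReal.ofReal a := by
    rw [← ENNReal.ofReal_toReal hκ.ne_top]
    exact ENNReal.ofReal_le_ofReal (le_max_left _ _)
  refine (pow_le_pow_left' h1 _).trans ?_
  rw [← ENNReal.ofReal_pow ha0.le]
  refine ENNReal.ofReal_le_ofReal ?_
  rw [inv_mul_eq_div, le_div_iff₀ ha0, ← pow_succ]
  calc a ^ (t / K + 1) = ρ ^ (K * (t / K + 1)) := by rw [pow_mul, hρK]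
    _ ≤ ρ ^ t := pow_le_pow_of_le_one hρ0.le hρ1.le (Nat.lt_mul_div_succ t hK).le

/-- The transition probabilities from `τ z` and from `z` differ by a factor close to one, up to
an exponentially small error. -/
theorem stepProb_comp_le {p : S → S → ℝ≥0∞} (hp : IsSubstochastic p) {τ : S ≃ S}
    (hinv : ∀ z u, p (τ z) (τ u) = p z u) (hτ : ∀ z, τ z ≠ z) {K : ℕ} (hK : 0 < K) {ε : ℝ≥0∞}
    (hε : ε ≠ 0) (h1 : ∀ z, ε ≤ stepProb p K z z) (h2 : ∀ z, ε ≤ stepProb p K z (τ z))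
    {x : ℝ} (hx : 1 < x) :
    ∃ c ρ : ℝ, 0 < c ∧ 0 < ρ ∧ ρ < 1 ∧ ∀ (t : ℕ) (z z' : S),
      stepProb p t (τ z) z' ≤
        ENNReal.ofReal x * stepProb p t z z' + ENNReal.ofReal (c * ρ ^ t) := by
  classical
  have hP : kernelOp (stepProb p K) 1 ≤ 1 := by
    rw [kernelOp_stepProb]
    exact pow_kernelOp_le_one hp K le_rfl
  obtain ⟨c, κ, hc, hκ, hle⟩ :=
    pow_kernelOp_comp_le hP (stepProb_invariant hinv K) hτ hε h1 h2 hx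
  obtain ⟨c', ρ, hc', hρ0, hρ1, hpow⟩ := pow_div_le hκ hK
  refine ⟨(c.toReal + 1) * c', ρ, by positivity, hρ0, hρ1, fun t z z' => ?_⟩
  -- The leftover t % K steps go into the test function, so only powers of the K-step kernel are
  -- compared.
  have hf : (kernelOp p ^ (t % K)) (Pi.single z' 1) ≤ 1 :=
    pow_kernelOp_le_one hp _ fun u => by
      by_cases h : u = z' <;> simp [h]
  have hsplit : ∀ u, stepProb p t u z' = (kernelOp (stepProb p K) ^ (t / K))
      ((kernelOp p ^ (t % K)) (Pi.single z' 1)) u := by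
    intro u
    rw [kernelOp_stepProb, ← pow_mul, ← Module.End.mul_apply, ← pow_add, Nat.div_add_mod,
      stepProb_eq_pow_kernelOp]
  rw [hsplit, hsplit]
  refine (hle (t / K) _ hf z).trans (add_le_add_right ?_ _)
  rw [mul_assoc, ENNReal.ofReal_mul (by positivity)]
  refine mul_le_mul' ?_ (hpow t)
  rw [ENNReal.le_ofReal_iff_toReal_le hc.ne (by positivity)]
  linarith

end Ratio

/-! ### Paths, return times and positivity of the Green function -/

section Communication

variable {S : Type*}

theorem pow_le_stepProb_of_path {p : S → S → ℝ≥0∞} {θ : ℝ≥0∞} {path : ℕ → S} {n : ℕ}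
    (h : ∀ i < n, θ ≤ p (path i) (path (i + 1))) : θ ^ n ≤ stepProb p n (path 0) (path n) := by
  induction n with
  | zero => simp [stepProb]
  | succ n ih =>
    rw [pow_succ]
    refine le_trans (mul_le_mul' (ih fun i hi => h i (by omega)) ?_) (stepProb_add_ge p n 1 _ _ _)
    refine (h n (by omega)).trans (le_of_eq ?_)
    simp [stepProb]

theorem iInf_stepProb_pos_of_mem_closure {p : S → S → ℝ≥0∞} {k : ℕ}
    (hk : k ∈ AddSubmonoid.closure (returnTimes p)) : 0 < ⨅ z, stepProb p k z z := by
  induction hk using AddSubmonoid.closure_induction with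
  | mem k hk => exact hk.2
  | zero =>
    refine lt_of_lt_of_le zero_lt_one (le_iInf fun z => ?_)
    simp [stepProb]
  | add j k _ _ hj hk =>
    refine lt_of_lt_of_le (ENNReal.mul_pos hj.ne' hk.ne') (le_iInf fun z => ?_)
    exact (mul_le_mul' (iInf_le _ z) (iInf_le _ z)).trans (stepProb_add_ge p j k z z z)

theorem stepProb_le_green (p : S → S → ℝ≥0∞) (t : ℕ) (z z' : S) :
    stepProb p t z z' ≤ green p z z' :=
  ENNReal.le_tsum t

theorem stepProb_mul_green_le (p : S → S → ℝ≥0∞) (t : ℕ) (z u z' : S) :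
    stepProb p t z u * green p u z' ≤ green p z z' := by
  rw [green, green, ← ENNReal.tsum_mul_left]
  refine (ENNReal.tsum_le_tsum fun s => stepProb_add_ge p t s z u z').trans ?_
  exact ENNReal.tsum_comp_le_tsum_of_injective (add_right_injective t) fun s => stepProb p s z z'

end Communication

variable {d l : ℕ} {E : Set (EuclideanSpace ℝ (Fin l))}

theorem exists_stepProb_pos {p : State d E → State d E → ℝ≥0∞} (hcomm : CommunicationCondition p)
    (z z' : State d E) : ∃ n, stepProb p n z z' ≠ 0 := by
  by_cases h : z = z'
  · exact ⟨0, by simp [stepProb, h]⟩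
  obtain ⟨θ, hθ, C, _, H⟩ := hcomm
  obtain ⟨n, path, rfl, rfl, _, hp⟩ := H z z' h
  refine ⟨n, fun h0 => ?_⟩
  have := pow_le_stepProb_of_path fun i hi => (hp i hi).2
  rw [h0] at this
  simp [hθ.not_ge] at this

theorem green_ne_zero {p : State d E → State d E → ℝ≥0∞} (hcomm : CommunicationCondition p)
    (z z' : State d E) : green p z z' ≠ 0 := by
  obtain ⟨n, hn⟩ := exists_stepProb_pos hcomm z z'
  exact fun h => hn (le_antisymm (h ▸ stepProb_le_green p n z z') zero_le)

/-- Reaching z from z' has positive probability, so an infinite G(z, z') would make G(z', z')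
infinite. -/
theorem green_ne_top {p : State d E → State d E → ℝ≥0∞} (hcomm : CommunicationCondition p)
    (htrans : IsTransient p) (z z' : State d E) : green p z z' ≠ ∞ := by
  obtain ⟨n, hn⟩ := exists_stepProb_pos hcomm z' z
  intro h
  have := stepProb_mul_green_le p n z' z z'
  rw [h, ENNReal.mul_top hn, top_le_iff] at this
  exact (htrans z').ne this

/-- The translation `z ↦ z + (v, 0)`. -/
def shiftEquiv (E : Set (EuclideanSpace ℝ (Fin l))) (v : Fin d → ℤ) : State d E ≃ State d E :=
  (Equiv.addRight v).prodCongr (Equiv.refl E)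

@[simp] theorem shiftEquiv_apply (v : Fin d → ℤ) (z : State d E) :
    shiftEquiv E v z = shift z v := rfl

theorem shift_shift (z : State d E) (u v : Fin d → ℤ) : shift (shift z u) v = shift z (u + v) := by
  simp [shift, add_assoc]

@[simp] theorem shift_zero (z : State d E) : shift z 0 = z := by
  simp [shift]

theorem shift_ne_self {v : Fin d → ℤ} (hv : v ≠ 0) (z : State d E) : shift z v ≠ z := fun h =>
  hv (by simpa [shift] using congrArg Prod.fst h)

theorem IsMarkovAdditive.shift_shift {p : State d E → State d E → ℝ≥0∞}
    (hadd : IsMarkovAdditive p) (v : Fin d → ℤ) (z u : State d E) :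
    p (shift z v) (shift u v) = p z u := by
  obtain ⟨x, y⟩ := z
  obtain ⟨x', y'⟩ := u
  rw [shift, shift, hadd, hadd x x']
  simp

theorem toEuclid_shift (z : State d E) (v : Fin d → ℤ) :
    toEuclid (shift z v) = toEuclid z + WithLp.toLp 2 (Sum.elim (fun i => (v i : ℝ)) 0) := by
  ext i
  cases i <;> simp [toEuclid, shift]

/-- The translations by multiples of the period have a common step number `K` at which both the
return to a state and the translation have uniformly positive probability. -/
theorem exists_uniform_shift {p : State d E → State d E → ℝ≥0∞} (hadd : IsMarkovAdditive p)
    (hcomm : CommunicationCondition p) {w : Fin d → ℤ} (hw : w ≠ 0) (hper : 0 < period p) :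
    ∃ K : ℕ, 0 < K ∧ ∃ ε : ℝ≥0∞, ε ≠ 0 ∧ ∀ z, ε ≤ stepProb p K z z ∧
      ε ≤ stepProb p K z (shift z (period p • w)) := by
  obtain ⟨θ, hθ, C, hC, H⟩ := hcomm
  set k := period p with hk
  obtain ⟨N, hN⟩ := Nat.exists_mem_closure_of_ge (returnTimes p)
  set R : ℝ := ‖(WithLp.toLp 2 (Sum.elim (fun i => (w i : ℝ)) 0) :
    EuclideanSpace ℝ (Fin d ⊕ Fin l))‖
  obtain ⟨B, hB⟩ := exists_nat_ge (C * R)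
  -- The path from z to z + w has a length n ≤ B depending on z. Repeated k times it takes nk steps;
  -- what remains of k(N + 1 + B) is a multiple of k large enough to be filled by uniform returns.
  -- The minimum over n ≤ B is then uniform in z.
  set g : ℕ → ℝ≥0∞ := fun n =>
    (ENNReal.ofReal θ ^ n) ^ k * ⨅ z, stepProb p (k * (N + 1 + B) - n * k) z z with hg
  have hmem : ∀ n ≤ B, 0 < ⨅ z, stepProb p (k * (N + 1 + B) - n * k) z z := by
    intro n hn
    refine iInf_stepProb_pos_of_mem_closure (hN _ ?_ ?_)
    · rw [mul_comm n, ← Nat.mul_sub]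
      calc N ≤ 1 * (N + 1 + B - n) := by omega
        _ ≤ _ := Nat.mul_le_mul_right _ hper
    · rw [mul_comm n, ← Nat.mul_sub]
      exact dvd_mul_right _ _
  have hgpos : ∀ n ∈ Finset.range (B + 1), 0 < g n := by
    intro n hn
    refine ENNReal.mul_pos ?_ (hmem n (by simpa [Nat.lt_succ_iff] using hn)).ne'
    simp [hθ.not_ge]
  have hpos : 0 < (Finset.range (B + 1)).inf g :=
    (Finset.lt_inf_iff (by simp)).2 hgpos
  refine ⟨k * (N + 1 + B), by positivity, min ((Finset.range (B + 1)).inf g)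
    (⨅ z, stepProb p (k * (N + 1 + B)) z z), ?_, fun z => ⟨?_, ?_⟩⟩
  · refine (lt_min hpos ?_).ne'
    simpa using hmem 0 (by omega)
  · exact (min_le_right _ _).trans (iInf_le _ z)
  refine (min_le_left _ _).trans ?_
  obtain ⟨n, path, h0, hn, hlen, hstep⟩ := H z (shift z w) (shift_ne_self hw z).symm
  have hnB : n ≤ B := by
    rw [toEuclid_shift, add_sub_cancel_left] at hlen
    exact_mod_cast hlen.trans hB
  have h1 : ENNReal.ofReal θ ^ n ≤ stepProb p n z (shift z w) := by
    have := pow_le_stepProb_of_path fun i hi => (hstep i hi).2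
    rwa [h0, hn] at this
  have hmul : ∀ j : ℕ, (ENNReal.ofReal θ ^ n) ^ j ≤ stepProb p (n * j) z (shift z (j • w)) := by
    intro j
    induction j with
    | zero => simp [stepProb]
    | succ j ih =>
      rw [pow_succ, Nat.mul_succ]
      refine le_trans (mul_le_mul' ih (h1.trans (le_of_eq ?_)))
        (stepProb_add_ge p (n * j) n z (shift z (j • w)) _)
      have := stepProb_invariant (τ := shiftEquiv E (j • w))
        (fun z u => hadd.shift_shift (j • w) z u) n z (shift z w)
      rw [← this, shiftEquiv_apply, shiftEquiv_apply, shift_shift, succ_nsmul, add_comm w]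
  refine (Finset.inf_le (Finset.mem_range.2 (Nat.lt_succ_iff.2 hnB))).trans ?_
  refine (mul_le_mul' (hmul k) (iInf_le _ (shift z (k • w)))).trans ?_
  refine (stepProb_add_ge p (n * k) _ z _ _).trans (le_of_eq ?_)
  rw [Nat.add_sub_of_le]
  rw [mul_comm n]
  exact Nat.mul_le_mul_left _ (by omega)

/-! ### Exponential decay in space -/

theorem stepProb_mul_exp_le (p : State d E → State d E → ℝ≥0∞)
    (a : EuclideanSpace ℝ (Fin d ⊕ Fin l)) (t : ℕ) (z z' : State d E) :
    stepProb p t z z' * ENNReal.ofReal (Real.exp (inner ℝ a (toEuclid z' - toEuclid z))) ≤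
      expMoment p a ^ t := by
  set h : State d E → ℝ≥0∞ := fun u => ENNReal.ofReal (Real.exp (inner ℝ a (toEuclid u))) with hh
  have hdiff : ∀ u u' : State d E,
      ENNReal.ofReal (Real.exp (inner ℝ a (toEuclid u' - toEuclid u))) * h u = h u' := by
    intro u u'
    rw [hh, ← ENNReal.ofReal_mul (Real.exp_pos _).le, ← Real.exp_add, inner_sub_right,
      sub_add_cancel]
  have hstep : kernelOp p h ≤ expMoment p a • h := by
    intro u
    have := le_iSup (fun z => ∑' z', p z z' *
      ENNReal.ofReal (Real.exp (inner ℝ a (toEuclid z' - toEuclid z)))) u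
    refine le_trans (le_of_eq ?_) (mul_le_mul_left this (h u))
    rw [kernelOp_apply, ← ENNReal.tsum_mul_right]
    simp only [mul_assoc, hdiff]
  have h1 := pow_kernelOp_le_smul hstep t z
  rw [← kernelOp_stepProb, kernelOp_apply] at h1
  have h2 := (ENNReal.le_tsum z').trans h1
  rw [← hdiff z z', ← mul_assoc] at h2
  exact (ENNReal.mul_le_mul_iff_left (by simp [hh, Real.exp_pos]) (by simp [hh])).1 h2

theorem exists_norm_le_card_mul {ι : Type*} [Fintype ι] [Nonempty ι] (u : EuclideanSpace ℝ ι) :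
    ∃ i, ‖u‖ ≤ Fintype.card ι * |u i| := by
  obtain ⟨i, hi⟩ := Finite.exists_max fun i => |u i|
  refine ⟨i, ?_⟩
  have hc : (1 : ℝ) ≤ Fintype.card ι := by exact_mod_cast Fintype.card_pos (α := ι)
  rw [EuclideanSpace.norm_eq]
  refine Real.sqrt_le_iff.2 ⟨by positivity, ?_⟩
  calc ∑ j, ‖u j‖ ^ 2 ≤ ∑ _j : ι, |u i| ^ 2 :=
        Finset.sum_le_sum fun j _ => pow_le_pow_left₀ (norm_nonneg _) (hi j) 2
    _ = Fintype.card ι * |u i| ^ 2 := by simp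
    _ ≤ (Fintype.card ι * |u i|) ^ 2 := by
        rw [mul_pow]
        gcongr
        nlinarith

theorem exists_stepProb_le_exp [Nonempty (Fin d ⊕ Fin l)] {p : State d E → State d E → ℝ≥0∞}
    (hA : ExpMomentCondition p) :
    ∃ M r : ℝ, 1 < M ∧ 0 < r ∧ ∀ (t : ℕ) (z z' : State d E), stepProb p t z z' ≤
      ENNReal.ofReal (M ^ t * Real.exp (-(r * ‖toEuclid z' - toEuclid z‖))) := by
  obtain ⟨δ, hδ, hball⟩ := Metric.eventually_nhds_iff.1 hA
  set r := δ / 2 with hr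
  have hr0 : 0 < r := by positivity
  have hfin : ∀ (i : Fin d ⊕ Fin l) (s : ℝ), |s| = r →
      expMoment p (EuclideanSpace.single i s) < ∞ := by
    intro i s hs
    refine hball ?_
    rw [dist_zero_right, PiLp.norm_single, Real.norm_eq_abs, hs]
    linarith
  set m : Fin d ⊕ Fin l → ℝ → ℝ := fun i s => (expMoment p (EuclideanSpace.single i s)).toReal
  -- Only the finitely many vectors ±r e_i are tested; for a given displacement the largest
  -- coordinate selects one, at the cost of a dimensional factor in the rate.
  set M : ℝ := 2 + ∑ i, (m i r + m i (-r)) with hM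
  have hm0 : ∀ i s, 0 ≤ m i s := fun i s => ENNReal.toReal_nonneg
  have hMle : ∀ i s, |s| = r → expMoment p (EuclideanSpace.single i s) ≤ ENNReal.ofReal M := by
    intro i s hs
    rw [ENNReal.le_ofReal_iff_toReal_le (hfin i s hs).ne
      (by have := Finset.sum_nonneg fun i (_ : i ∈ Finset.univ) =>
            add_nonneg (hm0 i r) (hm0 i (-r))
          positivity)]
    have h1 : m i r + m i (-r) ≤ ∑ i, (m i r + m i (-r)) :=
      Finset.single_le_sum (f := fun i => m i r + m i (-r))
        (fun i _ => add_nonneg (hm0 i r) (hm0 i (-r))) (Finset.mem_univ i)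
    have h2 : m i s ≤ m i r + m i (-r) := by
      rcases (abs_eq hr0.le).1 hs with rfl | rfl
      · linarith [hm0 i (-r)]
      · linarith [hm0 i r]
    change m i s ≤ M
    linarith
  have hM1 : 1 < M := by
    have := Finset.sum_nonneg fun i (_ : i ∈ Finset.univ) => add_nonneg (hm0 i r) (hm0 i (-r))
    linarith
  have hc : (0 : ℝ) < Fintype.card (Fin d ⊕ Fin l) := by exact_mod_cast Fintype.card_pos
  refine ⟨M, r / Fintype.card (Fin d ⊕ Fin l), hM1, by positivity, fun t z z' => ?_⟩
  obtain ⟨i, hi⟩ := exists_norm_le_card_mul (toEuclid z' - toEuclid z)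
  obtain ⟨s, hs, hsu⟩ : ∃ s : ℝ, |s| = r ∧
      s * (toEuclid z' - toEuclid z) i = r * |(toEuclid z' - toEuclid z) i| := by
    rcases abs_cases ((toEuclid z' - toEuclid z) i) with h | h
    · exact ⟨r, abs_of_pos hr0, by rw [h.1]⟩
    · exact ⟨-r, by rw [abs_neg, abs_of_pos hr0], by rw [h.1]; ring⟩
  have h1 := (stepProb_mul_exp_le p (EuclideanSpace.single i s) t z z').trans
    (pow_le_pow_left' (hMle i s hs) t)
  rw [EuclideanSpace.inner_single_left, conj_trivial, hsu] at h1
  set b := r * |(toEuclid z' - toEuclid z) i|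
  calc stepProb p t z z' = stepProb p t z z' * ENNReal.ofReal (Real.exp b) *
        ENNReal.ofReal (Real.exp (-b)) := by
        rw [mul_assoc, ← ENNReal.ofReal_mul (Real.exp_pos _).le, ← Real.exp_add]
        simp
    _ ≤ ENNReal.ofReal M ^ t * ENNReal.ofReal (Real.exp (-b)) := mul_le_mul_left h1 _
    _ = ENNReal.ofReal (M ^ t * Real.exp (-b)) := by
        rw [← ENNReal.ofReal_pow (by linarith), ENNReal.ofReal_mul (by positivity)]
    _ ≤ _ := by
        refine ENNReal.ofReal_le_ofReal ?_
        gcongr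
        rw [div_mul_eq_mul_div, div_le_iff₀ hc]
        calc _ ≤ r * (Fintype.card (Fin d ⊕ Fin l) * |(toEuclid z' - toEuclid z) i|) := by gcongr
          _ = _ := by ring

/-! ### Comparison of Green functions -/

/-- Interpolation between a bound for small times and a bound for large times. -/
theorem min_pow_exp_le {M r c ρ : ℝ} (hM : 1 < M) (hr : 0 < r) (hc : 0 < c) (hρ0 : 0 < ρ)
    (hρ1 : ρ < 1) : ∃ C q β : ℝ, 0 < C ∧ 0 < q ∧ q < 1 ∧ 0 < β ∧ ∀ (t : ℕ) (s : ℝ),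
      min (M ^ t * Real.exp (-(r * s))) (c * ρ ^ t) ≤ C * q ^ t * Real.exp (-(β * s)) := by
  have hlogM : 0 < Real.log M := Real.log_pos hM
  have hlogρ : Real.log ρ < 0 := Real.log_neg hρ0 hρ1
  -- The minimum is at most the geometric mean with weights θ and 1 - θ; this θ makes θ log M + (1 -
  -- θ) log ρ = (log ρ)/2 < 0.
  set θ : ℝ := -Real.log ρ / (2 * (Real.log M - Real.log ρ)) with hθ
  have hθ0 : 0 < θ := div_pos (by linarith) (by linarith)
  have hθ1 : θ < 1 := (div_lt_one (by linarith)).2 (by linarith)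
  have hθe : θ * (Real.log M - Real.log ρ) = -Real.log ρ / 2 := by
    have : Real.log M - Real.log ρ ≠ 0 := by linarith
    rw [hθ]
    field_simp
  refine ⟨Real.exp ((1 - θ) * Real.log c), Real.exp (Real.log ρ / 2), θ * r, Real.exp_pos _,
    Real.exp_pos _, by rw [Real.exp_lt_one_iff]; linarith, by positivity, fun t s => ?_⟩
  have h1 : M ^ t * Real.exp (-(r * s)) = Real.exp (t * Real.log M - r * s) := by
    rw [sub_eq_add_neg, Real.exp_add, Real.exp_nat_mul, Real.exp_log (by linarith)]
  have h2 : c * ρ ^ t = Real.exp (Real.log c + t * Real.log ρ) := by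
    rw [Real.exp_add, Real.exp_nat_mul, Real.exp_log hc, Real.exp_log hρ0]
  have h3 : Real.exp ((1 - θ) * Real.log c) * Real.exp (Real.log ρ / 2) ^ t *
      Real.exp (-(θ * r * s)) =
      Real.exp (θ * (t * Real.log M - r * s) + (1 - θ) * (Real.log c + t * Real.log ρ)) := by
    rw [← Real.exp_nat_mul, ← Real.exp_add, ← Real.exp_add]
    congr 1
    linear_combination (-(t : ℝ)) * hθe
  rw [h1, h2, h3, min_le_iff, Real.exp_le_exp, Real.exp_le_exp]
  rcases le_total (t * Real.log M - r * s) (Real.log c + t * Real.log ρ) with h | h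
  · exact Or.inl (by nlinarith)
  · exact Or.inr (by nlinarith)

theorem green_shift_le_add_exp {p : State d E → State d E → ℝ≥0∞} (hsub : IsSubstochastic p)
    (hadd : IsMarkovAdditive p) (hcomm : CommunicationCondition p) (hA : ExpMomentCondition p)
    {w : Fin d → ℤ} (hv : period p • w ≠ 0) {x : ℝ} (hx : 1 < x) :
    ∃ C β : ℝ, 0 < C ∧ 0 < β ∧ ∀ z z' : State d E,
      green p (shift z (period p • w)) z' ≤ ENNReal.ofReal x * green p z z' +
        ENNReal.ofReal
          (C * Real.exp (-(β * ‖toEuclid z' - toEuclid (shift z (period p • w))‖))) := by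
  have hw : w ≠ 0 := fun h => hv (by rw [h, smul_zero])
  have hper : 0 < period p := Nat.pos_of_ne_zero fun h => hv (by rw [h, zero_smul])
  obtain ⟨i, -⟩ := Function.ne_iff.1 hw
  have : Nonempty (Fin d ⊕ Fin l) := ⟨Sum.inl i⟩
  obtain ⟨K, hK, ε, hε, hKε⟩ := exists_uniform_shift hadd hcomm hw hper
  obtain ⟨c, ρ, hc, hρ0, hρ1, hratio⟩ := stepProb_comp_le hsub
    (τ := shiftEquiv E (period p • w)) (fun z u => hadd.shift_shift _ z u)
    (fun z => shift_ne_self hv z) hK hε (fun z => (hKε z).1) (fun z => (hKε z).2) hx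
  obtain ⟨M, r, hM, hr, hexp⟩ := exists_stepProb_le_exp hA
  obtain ⟨C, q, β, hC, hq0, hq1, hβ, hmin⟩ := min_pow_exp_le hM hr hc hρ0 hρ1
  refine ⟨C * (1 - q)⁻¹, β, mul_pos hC (inv_pos.2 (by linarith)), hβ, fun z z' => ?_⟩
  set s := ‖toEuclid z' - toEuclid (shift z (period p • w))‖ with hs
  have hterm : ∀ t, stepProb p t (shift z (period p • w)) z' ≤
      ENNReal.ofReal x * stepProb p t z z' +
        ENNReal.ofReal (C * q ^ t * Real.exp (-(β * s))) := by
    intro t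
    have h1 := hexp t (shift z (period p • w)) z'
    have h2 := hratio t z z'
    rw [shiftEquiv_apply] at h2
    rcases min_le_iff.1 (hmin t s) with h | h
    · exact (h1.trans (ENNReal.ofReal_le_ofReal h)).trans le_add_self
    · exact h2.trans (add_le_add_right (ENNReal.ofReal_le_ofReal h) _)
  have hgeom := (((hasSum_geometric_of_lt_one hq0.le hq1).mul_left C).mul_right
    (Real.exp (-(β * s))))
  refine (ENNReal.tsum_le_tsum hterm).trans (le_of_eq ?_)
  rw [ENNReal.tsum_add, ENNReal.tsum_mul_left, ← ENNReal.ofReal_tsum_of_nonneg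
    (fun t => by positivity) hgeom.summable, hgeom.tsum_eq]
  rfl

theorem exp_neg_le_green_of_log {G : ℝ≥0∞} {s γ : ℝ} (hs : 0 < s)
    (h : ((-γ : ℝ) : EReal) < ((1 / s : ℝ) : EReal) * ENNReal.log G) :
    ENNReal.ofReal (Real.exp (-(γ * s))) ≤ G := by
  by_contra! hlt
  refine h.not_ge ?_
  have h1 := ENNReal.log_le_log hlt.le
  rw [ENNReal.log_ofReal, if_neg (Real.exp_pos _).not_ge, Real.log_exp] at h1
  refine (mul_le_mul_of_nonneg_left h1 (EReal.coe_nonneg.2 (by positivity))).trans (le_of_eq ?_)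
  rw [← EReal.coe_mul]
  congr 1
  field_simp

theorem exists_exp_neg_le_green {p : State d E → State d E → ℝ≥0∞} {zs : ℕ → State d E}
    (hzs : Tendsto (fun n => size (zs n)) atTop atTop)
    (hlog : ∃ L : EReal, 0 ≤ L ∧
      Tendsto
        (lowerLim zs fun z z' => (((1 / size z' : ℝ) : EReal) * ENNReal.log (green p z z')))
        (𝓝[>] (0 : ℝ)) (𝓝 L)) {γ : ℝ} (hγ : 0 < γ) :
    ∃ δ > 0, ∀ᶠ n in atTop, ∀ z : State d E, size z < δ * size (zs n) →
      ENNReal.ofReal (Real.exp (-(γ * size (zs n)))) ≤ green p z (zs n) := by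
  obtain ⟨L, hL, hlim⟩ := hlog
  have hlt : ((-γ : ℝ) : EReal) < L :=
    lt_of_lt_of_le (EReal.coe_neg'.2 (by linarith)) hL
  obtain ⟨δ, hδ, hδ0⟩ :=
    ((hlim.eventually (lt_mem_nhds hlt)).and self_mem_nhdsWithin).exists
  refine ⟨δ, hδ0, ?_⟩
  filter_upwards [eventually_lt_of_lt_liminf hδ, hzs.eventually_gt_atTop 0] with n hn hs z hz
  exact exp_neg_le_green_of_log hs (hn.trans_le (iInf₂_le z hz))

theorem size_shift_le (z : State d E) (v : Fin d → ℤ) : size (shift z v) ≤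
    size z + ‖(WithLp.toLp 2 (Sum.elim (fun i => (v i : ℝ)) 0) :
      EuclideanSpace ℝ (Fin d ⊕ Fin l))‖ := by
  rw [size, toEuclid_shift]
  exact norm_add_le _ _

theorem exists_green_shift_le {p : State d E → State d E → ℝ≥0∞} (hsub : IsSubstochastic p)
    (hadd : IsMarkovAdditive p) (hcomm : CommunicationCondition p) (hA : ExpMomentCondition p)
    {zs : ℕ → State d E} (hzs : Tendsto (fun n => size (zs n)) atTop atTop)
    (hlog : ∃ L : EReal, 0 ≤ L ∧
      Tendsto
        (lowerLim zs fun z z' => (((1 / size z' : ℝ) : EReal) * ENNReal.log (green p z z')))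
        (𝓝[>] (0 : ℝ)) (𝓝 L))
    (w : Fin d → ℤ) {x : ℝ≥0∞} (hx : 1 < x) :
    ∃ δ > 0, ∀ᶠ n in atTop, ∀ z : State d E, size z < δ * size (zs n) →
      green p (shift z (period p • w)) (zs n) ≤ x * green p z (zs n) := by
  -- This covers w = 0 and period 0, that is, no uniform return times.
  by_cases hv : period p • w = 0
  · refine ⟨1, one_pos, Eventually.of_forall fun n z _ => ?_⟩
    rw [hv, shift_zero]
    exact le_mul_of_one_le_left' hx.le
  obtain ⟨b, hb1, hbx⟩ := ENNReal.lt_iff_exists_real_btwn.1 hx |>.imp fun b hb => hb.2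
  have hb : 1 < b := by simpa using hb1
  set a : ℝ := (1 + b) / 2 with ha
  obtain ⟨C, β, hC, hβ, hG⟩ := green_shift_le_add_exp hsub hadd hcomm hA hv
    (x := a) (by linarith)
  -- The distance from τz to z_n will be at least s/2, so the error is at most C exp(-βs/2): one
  -- factor exp(-βs/4) is bounded by G, the other brings C below b - a.
  obtain ⟨δ, hδ, hlow⟩ := exists_exp_neg_le_green hzs hlog (γ := β / 4) (by positivity)
  set R := ‖(WithLp.toLp 2 (Sum.elim (fun i => ((period p • w) i : ℝ)) 0) :
      EuclideanSpace ℝ (Fin d ⊕ Fin l))‖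
  have herr : Tendsto (fun n => C * Real.exp (-(β / 4 * size (zs n)))) atTop (𝓝 (C * 0)) :=
    (Real.tendsto_exp_neg_atTop_nhds_zero.comp
      (hzs.const_mul_atTop (by positivity : 0 < β / 4))).const_mul C
  have herr' := herr.eventually (gt_mem_nhds (by rw [mul_zero]; linarith : C * 0 < b - a))
  refine ⟨min δ (1 / 4), by positivity, ?_⟩
  filter_upwards [hlow, herr', hzs.eventually_ge_atTop (4 * R), hzs.eventually_gt_atTop 0]
    with n hn herrn hR hs z hz
  set s := size (zs n) with hsdef
  have hz1 : size z < δ * s := hz.trans_le (by gcongr; exact min_le_left _ _)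
  have hz2 : size z < 1 / 4 * s := hz.trans_le (by gcongr; exact min_le_right _ _)
  have hdist : s / 2 ≤ ‖toEuclid (zs n) - toEuclid (shift z (period p • w))‖ := by
    have h1 := norm_sub_norm_le (toEuclid (zs n)) (toEuclid (shift z (period p • w)))
    have h2 := size_shift_le z (period p • w)
    change s - size (shift z (period p • w)) ≤ _ at h1
    linarith
  have hsmall : ENNReal.ofReal
      (C * Real.exp (-(β * ‖toEuclid (zs n) - toEuclid (shift z (period p • w))‖))) ≤
      ENNReal.ofReal (b - a) * green p z (zs n) := by
    refine le_trans ?_ (mul_le_mul_right (hn z hz1) _)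
    rw [← ENNReal.ofReal_mul (by linarith)]
    refine ENNReal.ofReal_le_ofReal ?_
    calc _ ≤ C * Real.exp (-(β / 4 * s) + -(β / 4 * s)) := by
          gcongr
          nlinarith
      _ = C * Real.exp (-(β / 4 * s)) * Real.exp (-(β / 4 * s)) := by
          rw [Real.exp_add]; ring
      _ ≤ _ := by gcongr
  calc _ ≤ _ := hG z (zs n)
    _ ≤ ENNReal.ofReal a * green p z (zs n) + ENNReal.ofReal (b - a) * green p z (zs n) :=
        add_le_add_right hsmall _
    _ = ENNReal.ofReal b * green p z (zs n) := by
        rw [← add_mul, ← ENNReal.ofReal_add (by linarith) (by linarith), add_sub_cancel]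
    _ ≤ _ := mul_le_mul_left hbx.le _

theorem exists_green_le_shift {p : State d E → State d E → ℝ≥0∞} (hsub : IsSubstochastic p)
    (hadd : IsMarkovAdditive p) (hcomm : CommunicationCondition p) (hA : ExpMomentCondition p)
    {zs : ℕ → State d E} (hzs : Tendsto (fun n => size (zs n)) atTop atTop)
    (hlog : ∃ L : EReal, 0 ≤ L ∧
      Tendsto
        (lowerLim zs fun z z' => (((1 / size z' : ℝ) : EReal) * ENNReal.log (green p z z')))
        (𝓝[>] (0 : ℝ)) (𝓝 L))
    (w : Fin d → ℤ) {x : ℝ≥0∞} (hx : 1 < x) :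
    ∃ δ > 0, ∀ᶠ n in atTop, ∀ z : State d E, size z < δ * size (zs n) →
      green p z (zs n) ≤ x * green p (shift z (period p • w)) (zs n) := by
  -- Translation by -w is applied at the shifted point; halving δ keeps that point in the admissible
  -- ball.
  obtain ⟨δ, hδ, h⟩ := exists_green_shift_le hsub hadd hcomm hA hzs hlog (-w) hx
  refine ⟨δ / 2, by positivity, ?_⟩
  filter_upwards [h, (hzs.const_mul_atTop (by positivity : 0 < δ / 2)).eventually_ge_atTop
    ‖(WithLp.toLp 2 (Sum.elim (fun i => ((period p • w) i : ℝ)) 0) :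
      EuclideanSpace ℝ (Fin d ⊕ Fin l))‖] with n hn hR z hz
  have h1 := size_shift_le z (period p • w)
  have h2 := hn (shift z (period p • w)) (by linarith)
  rwa [shift_shift, smul_neg, add_neg_cancel, shift_zero] at h2

/-! ### Passage to the limits -/

theorem tendsto_lowerLim_upperLim_one {zs : ℕ → State d E}
    (hzs : Tendsto (fun n => size (zs n)) atTop atTop) {f : State d E → State d E → ℝ≥0∞}
    (hf : ∀ x : ℝ≥0∞, 1 < x → ∃ δ > 0, ∀ᶠ n in atTop, ∀ z : State d E,
      size z < δ * size (zs n) → x⁻¹ ≤ f z (zs n) ∧ f z (zs n) ≤ x) :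
    Tendsto (lowerLim zs f) (𝓝[>] (0 : ℝ)) (𝓝 1) ∧
      Tendsto (upperLim zs f) (𝓝[>] (0 : ℝ)) (𝓝 1) := by
  have key : ∀ x : ℝ≥0∞, 1 < x → ∀ᶠ δ in 𝓝[>] (0 : ℝ),
      x⁻¹ ≤ lowerLim zs f δ ∧ upperLim zs f δ ≤ x := by
    intro x hx
    obtain ⟨δ₀, hδ₀, h⟩ := hf x hx
    filter_upwards [Ioo_mem_nhdsGT hδ₀] with δ hδ
    have h' : ∀ᶠ n in atTop, ∀ z : State d E, size z < δ * size (zs n) →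
        x⁻¹ ≤ f z (zs n) ∧ f z (zs n) ≤ x := by
      filter_upwards [h] with n hn z hz
      exact hn z (hz.trans_le (mul_le_mul_of_nonneg_right hδ.2.le (norm_nonneg _)))
    constructor
    · refine le_liminf_of_le (by isBoundedDefault) ?_
      filter_upwards [h'] with n hn
      exact le_iInf₂ fun z hz => (hn z hz).1
    · refine limsup_le_of_le (by isBoundedDefault) ?_
      filter_upwards [h'] with n hn
      exact iSup₂_le fun z hz => (hn z hz).2
  have hle : ∀ᶠ δ in 𝓝[>] (0 : ℝ), lowerLim zs f δ ≤ upperLim zs f δ := by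
    filter_upwards [self_mem_nhdsWithin] with δ hδ
    refine le_trans (liminf_le_limsup (by isBoundedDefault) (by isBoundedDefault))
      (limsup_le_limsup ?_ (by isBoundedDefault) (by isBoundedDefault))
    -- Infimum ≤ supremum needs a nonempty ball; `zs 0` eventually lies in it.
    filter_upwards [(hzs.const_mul_atTop hδ).eventually_gt_atTop (size (zs 0))] with n hn
    exact (iInf₂_le (zs 0) hn).trans
      (le_iSup₂ (f := fun (z : State d E) (_ : z ∈ {z : State d E | size z < δ * size (zs n)}) =>
        f z (zs n)) (zs 0) hn)
  have hlow : ∀ a < (1 : ℝ≥0∞), ∀ᶠ δ in 𝓝[>] (0 : ℝ), a < lowerLim zs f δ := by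
    intro a ha
    obtain ⟨x, hx1, hxa⟩ := exists_between (ENNReal.one_lt_inv.2 ha)
    filter_upwards [key x hx1] with δ hδ
    exact (ENNReal.lt_inv_iff_lt_inv.1 hxa).trans_le hδ.1
  have hupp : ∀ b > (1 : ℝ≥0∞), ∀ᶠ δ in 𝓝[>] (0 : ℝ), upperLim zs f δ < b := by
    intro b hb
    obtain ⟨x, hx1, hxb⟩ := exists_between hb
    filter_upwards [key x hx1] with δ hδ
    exact hδ.2.trans_lt hxb
  refine ⟨tendsto_order.2 ⟨hlow, fun b hb => ?_⟩, tendsto_order.2 ⟨fun a ha => ?_, hupp⟩⟩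
  · filter_upwards [hupp b hb, hle] with δ h1 h2
    exact h2.trans_lt h1
  · filter_upwards [hlow a ha, hle] with δ h1 h2
    exact h1.trans_le h2

end MarkovAdditive

theorem proposition7p3 {d l : ℕ} (E : Set (EuclideanSpace ℝ (Fin l))) (hE : E.Countable)
    (p : MarkovAdditive.State d E → MarkovAdditive.State d E → ℝ≥0∞)
    (hsub : MarkovAdditive.IsSubstochastic p)
    (hadd : MarkovAdditive.IsMarkovAdditive p)
    (htrans : MarkovAdditive.IsTransient p)
    (hcomm : MarkovAdditive.CommunicationCondition p)
    (hA2 : MarkovAdditive.ExpMomentCondition p)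
    (zs : ℕ → MarkovAdditive.State d E)
    (hzs : Tendsto (fun n => MarkovAdditive.size (zs n)) atTop atTop)
    (hlog : ∃ L : EReal, 0 ≤ L ∧
      Tendsto
        (MarkovAdditive.lowerLim zs fun z z' =>
          (((1 / MarkovAdditive.size z' : ℝ) : EReal) * ENNReal.log (MarkovAdditive.green p z z')))
        (𝓝[>] (0 : ℝ)) (𝓝 L))
    (w : Fin d → ℤ) :
    Tendsto
        (MarkovAdditive.lowerLim zs fun z z' =>
          MarkovAdditive.green p (MarkovAdditive.shift z (MarkovAdditive.period p • w)) z' /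
            MarkovAdditive.green p z z')
        (𝓝[>] (0 : ℝ)) (𝓝 1) ∧
      Tendsto
        (MarkovAdditive.upperLim zs fun z z' =>
          MarkovAdditive.green p (MarkovAdditive.shift z (MarkovAdditive.period p • w)) z' /
            MarkovAdditive.green p z z')
        (𝓝[>] (0 : ℝ)) (𝓝 1) := by
  refine MarkovAdditive.tendsto_lowerLim_upperLim_one hzs fun x hx => ?_
  obtain ⟨δ₁, hδ₁, h₁⟩ := MarkovAdditive.exists_green_shift_le hsub hadd hcomm hA2 hzs hlog w hx
  obtain ⟨δ₂, hδ₂, h₂⟩ := MarkovAdditive.exists_green_le_shift hsub hadd hcomm hA2 hzs hlog w hx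
  refine ⟨min δ₁ δ₂, lt_min hδ₁ hδ₂, ?_⟩
  filter_upwards [h₁, h₂] with n hn₁ hn₂ z hz
  have hs : 0 ≤ MarkovAdditive.size (zs n) := norm_nonneg _
  refine ⟨?_, ENNReal.div_le_of_le_mul
    (hn₁ z (hz.trans_le (mul_le_mul_of_nonneg_right (min_le_left _ _) hs)))⟩
  rw [ENNReal.le_div_iff_mul_le (Or.inl (MarkovAdditive.green_ne_zero hcomm _ _))
    (Or.inl (MarkovAdditive.green_ne_top hcomm htrans _ _)), mul_comm, ← div_eq_mul_inv]
  refine ENNReal.div_le_of_le_mul ?_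
  rw [mul_comm]
  exact hn₂ z (hz.trans_le (mul_le_mul_of_nonneg_right (min_le_right _ _) hs))
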